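/- Notation and definitions. $\mathbb{R}^n$ carries its Euclidean structure. A function on a Euclidean space is of class $C^{1,1}_{\mathrm{loc}}$ if it is differentiable with locally Lipschitz gradient. A function $c:Z\to\mathbb{R}$ on a Euclidean space $Z$ is essentially coercive if there is a linear function $\ell:Z\to\mathbb{R}$ with $c(x)-\ell(x)\to\infty$ as $|x|\to\infty$. For a convex function $F:\mathbb{R}^n\to\mathbb{R}$, $X_F$ denotes the unique linear subspace $X$ of $\mathbb{R}^n$ such that $F(x)=c(P_X(x))+\langle v,x\rangle$ for all $x\in\mathbb{R}^n$, for some essentially coercive $c:X\to\mathbb{R}$ and some $v\in X^{\perp}$, where $P_X:\mathbb{R}^n\to X$ is the orthogonal projection. $B_X(0,R)$ is the closed ball of $X$ with center $0$ and radius $R$. The convex envelope of $g:\mathbb{R}^n\to\mathbb{R}$ is $\mathrm{conv}(g)(x)=\sup\{h(x): h:\mathbb{R}^n\to\mathbb{R}\text{ convex},\ h\le g\}$. Theorem. Let $E\subseteq\mathbb{R}^n$ be an arbitrary nonempty set, $X\subseteq\mathbb{R}^n$ a linear subspace, $P=P_X:\mathbb{R}^n\to X$ the orthogonal projection, and $f:E\to\mathbb{R}$,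 $G:E\to\mathbb{R}^n$ two functions. There exists a convex function $F:\mathbb{R}^n\to\mathbb{R}$ of class $C^{1,1}_{\mathrm{loc}}$ such that $F|_E=f$, $(\nabla F)|_E=G$ and $X_F=X$, if and only if the following conditions are satisfied. (i) $Y:=\mathrm{span}\{G(y)-G(z): y,z\in E\}\subseteq X$. (ii) If $k:=\dim Y<d:=\dim X$, then there exist distinct points $p_1,\dots,p_{d-k}\in\mathbb{R}^n\setminus E$, numbers $\beta_1,\dots,\beta_{d-k}\in\mathbb{R}$, vectors $w_1,\dots,w_{d-k}\in\mathbb{R}^n$ and, for every $y\in E^*:=E\cup\{p_1,\dots,p_{d-k}\}$, a (not necessarily convex) function $\varphi_y:X\to[0,\infty)$ of class $C^{1,1}_{\mathrm{loc}}$ such that, writing $t_y:=f(y)$, $\xi_y:=G(y)$ for $y\in E$ and $t_{p_j}:=\beta_j$, $\xi_{p_j}:=w_j$ for $j=1,\dots,d-k$, we have: $$\mathrm{span}\{\xi_y-\xi_z: y,z\in E^*\}=X;$$ $$\varphi_y(P(y))=0\quad\text{and}\quad\nabla\varphi_y(P(y))=0\quad\text{for every }y\in E^*;$$ $$\sup\left\{\frac{|\nabla\varphi_y(u)-\nabla\varphi_y(v)|}{|u-v|}: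 y\in E^*\cap P^{-1}(B_X(0,R)),\ u,v\in B_X(0,R),\ u\ne v\right\}<\infty\quad\text{for every }R>0;$$ $$t_z+\langle\xi_z,x-z\rangle\le t_y+\langle\xi_y,x-y\rangle+\varphi_y(P(x))\quad\text{for all }y,z\in E^*\text{ and }x\in\mathbb{R}^n.$$ (iii) If $k=d$, then the preceding condition holds with $E$ in place of $E^*$ (no data are added). Moreover, whenever (i) holds and $p_j,\beta_j,w_j,\varphi_y$ are as in (ii) (or, if $k=d$, $\varphi_y$ are as in (iii), with $E^*=E$), for every number $a>0$ the formula $$F=\mathrm{conv}\left(x\mapsto\inf_{y\in E^*}\left\{t_y+\langle\xi_y,x-y\rangle+\varphi_y(P(x))+a|P(x-y)|^2\right\}\right)$$ (in which the infimum and the supremum that defines the convex envelope are finite) defines a convex function of class $C^{1,1}_{\mathrm{loc}}$ on $\mathbb{R}^n$ with $F|_E=f$, $(\nabla F)|_E=G$ and $X_F=X$. -/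

import Mathlib

open scoped InnerProductSpace

/-- A function `f : Z → ℝ` on a Euclidean space is of class `C^{1,1}_loc` if it is differentiable
and its gradient is locally Lipschitz. -/
def IsC11Loc {Z : Type*} [NormedAddCommGroup Z] [InnerProductSpace ℝ Z] [CompleteSpace Z]
    (f : Z → ℝ) : Prop :=
  Differentiable ℝ f ∧ LocallyLipschitz (gradient f)

/-- `c` is essentially coercive: `c(x) - ℓ(x) → ∞` as `|x| → ∞` for some linear function `ℓ`. -/
def EssentiallyCoercive {Z : Type*} [NormedAddCommGroup Z] [InnerProductSpace ℝ Z]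
    (c : Z → ℝ) : Prop :=
  ∃ l : Z →ₗ[ℝ] ℝ, Filter.Tendsto (fun x => c x - l x) (Bornology.cobounded Z) Filter.atTop

/-- The relation `X_F = X`. For a convex function `F` there is exactly one linear subspace `X`
for which `F = c ∘ P_X + ⟨v, ·⟩` with `c : X → ℝ` essentially coercive and `v ∈ X^⊥`; it is
denoted by `X_F`. -/
def HasCoercivitySubspace {n : ℕ} (F : EuclideanSpace ℝ (Fin n) → ℝ)
    (X : Submodule ℝ (EuclideanSpace ℝ (Fin n))) : Prop :=
  ∃ c : X → ℝ, ∃ v ∈ Xᗮ, EssentiallyCoercive c ∧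
    ∀ x, F x = c (X.orthogonalProjectionOnto x) + ⟪v, x⟫_ℝ

/-- `F` is a convex `C^{1,1}_loc` extension of the jet `(f, G)` from `E` to `ℝⁿ`,
with `X_F = X`. -/
structure IsConvexC11Extension {n : ℕ} (E : Set (EuclideanSpace ℝ (Fin n)))
    (X : Submodule ℝ (EuclideanSpace ℝ (Fin n)))
    (f : E → ℝ) (G : E → EuclideanSpace ℝ (Fin n))
    (F : EuclideanSpace ℝ (Fin n) → ℝ) : Prop where
  convex : ConvexOn ℝ Set.univ F
  c11 : IsC11Loc F
  value : ∀ y : E, F y = f y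
  grad : ∀ y : E, gradient F y = G y
  subspace : HasCoercivitySubspace F X

/-- `span {ξ_i - ξ_j : i, j}`. -/
def diffSpan {ι V : Type*} [AddCommGroup V] [Module ℝ V] (ξ : ι → V) : Submodule ℝ V :=
  Submodule.span ℝ {u | ∃ i j, u = ξ i - ξ j}

/-- The conditions imposed on a family of points `q i`, with jets `(t i, ξ i)` and functions
`φ i : X → [0, ∞)`. -/
structure TangentConditions {n : ℕ} (X : Submodule ℝ (EuclideanSpace ℝ (Fin n)))
    {ι : Type*} (q : ι → EuclideanSpace ℝ (Fin n)) (t : ι → ℝ)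
    (ξ : ι → EuclideanSpace ℝ (Fin n)) (φ : ι → X → ℝ) : Prop where
  nonneg : ∀ i u, 0 ≤ φ i u
  c11 : ∀ i, IsC11Loc (φ i)
  span_eq : diffSpan ξ = X
  value_zero : ∀ i, φ i (X.orthogonalProjectionOnto (q i)) = 0
  grad_zero : ∀ i, gradient (φ i) (X.orthogonalProjectionOnto (q i)) = 0
  lipschitz : ∀ R : ℝ, 0 < R → BddAbove {s : ℝ | ∃ i, ∃ u v : X,
    ‖X.orthogonalProjectionOnto (q i)‖ ≤ R ∧ ‖u‖ ≤ R ∧ ‖v‖ ≤ R ∧ u ≠ v ∧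
      s = ‖gradient (φ i) u - gradient (φ i) v‖ / ‖u - v‖}
  tangent : ∀ i j x, t j + ⟪ξ j, x - q j⟫_ℝ ≤
    t i + ⟪ξ i, x - q i⟫_ℝ + φ i (X.orthogonalProjectionOnto x)

/-- The dimension defect `dim X - dim Y`, where `Y = span {G(y) - G(z) : y, z ∈ E}`
(used for `Y ⊆ X` only). -/
noncomputable def defect {n : ℕ} {E : Set (EuclideanSpace ℝ (Fin n))}
    (X : Submodule ℝ (EuclideanSpace ℝ (Fin n))) (G : E → EuclideanSpace ℝ (Fin n)) : ℕ :=
  Module.finrank ℝ X - Module.finrank ℝ (diffSpan G)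

/-- The set `E* = E ∪ {p_1, …, p_m}` as a family of points, indexed by the disjoint union of `E`
and `Fin m`. For `m = 0` this is `E`. -/
def enlarge {n m : ℕ} (E : Set (EuclideanSpace ℝ (Fin n)))
    (p : Fin m → EuclideanSpace ℝ (Fin n)) : E ⊕ Fin m → EuclideanSpace ℝ (Fin n) :=
  Sum.elim (fun y : E => (y : EuclideanSpace ℝ (Fin n))) p

/-- The data `p_j, β_j, w_j` (`j < m`) and `φ` are admissible for the jet `(f, G)` on `E`:
the `p_j` are distinct points outside `E` (so that `E*` is indexed bijectively), and the
conditions hold for `E*`, with jets `(f(y), G(y))` at `y ∈ E` and `(β_j, w_j)` at `p_j`. -/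
structure IsAdmissible {n : ℕ} (E : Set (EuclideanSpace ℝ (Fin n)))
    (X : Submodule ℝ (EuclideanSpace ℝ (Fin n)))
    (f : E → ℝ) (G : E → EuclideanSpace ℝ (Fin n))
    {m : ℕ} (p : Fin m → EuclideanSpace ℝ (Fin n)) (β : Fin m → ℝ)
    (w : Fin m → EuclideanSpace ℝ (Fin n)) (φ : E ⊕ Fin m → X → ℝ) : Prop where
  notMem : ∀ j, p j ∉ E
  injective : Function.Injective p
  conditions : TangentConditions X (enlarge E p) (Sum.elim f β) (Sum.elim G w) φ

/-- The values at `x` of the convex functions on `ℝⁿ` lying below `g`. -/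
def convexMinorantValues {n : ℕ} (g : EuclideanSpace ℝ (Fin n) → ℝ)
    (x : EuclideanSpace ℝ (Fin n)) : Set ℝ :=
  {s | ∃ h : EuclideanSpace ℝ (Fin n) → ℝ, ConvexOn ℝ Set.univ h ∧ (∀ z, h z ≤ g z) ∧ s = h x}

/-- The convex envelope `conv(g)(x) = sup {h(x) : h convex, h ≤ g}`. -/
noncomputable def convexEnvelope {n : ℕ} (g : EuclideanSpace ℝ (Fin n) → ℝ)
    (x : EuclideanSpace ℝ (Fin n)) : ℝ :=
  sSup (convexMinorantValues g x)

/-- The function `t_i + ⟨ξ_i, x - q_i⟩ + φ_i(P(x)) + a |P(x - q_i)|²` of `x`. -/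
noncomputable def upperTangent {n : ℕ} (X : Submodule ℝ (EuclideanSpace ℝ (Fin n)))
    {ι : Type*} (q : ι → EuclideanSpace ℝ (Fin n)) (t : ι → ℝ)
    (ξ : ι → EuclideanSpace ℝ (Fin n)) (φ : ι → X → ℝ) (a : ℝ)
    (x : EuclideanSpace ℝ (Fin n)) (i : ι) : ℝ :=
  t i + ⟪ξ i, x - q i⟫_ℝ + φ i (X.orthogonalProjectionOnto x)
    + a * ‖X.orthogonalProjectionOnto (x - q i)‖ ^ 2

/-- `x ↦ inf_{y ∈ E*} {t_y + ⟨ξ_y, x - y⟩ + φ_y(P(x)) + a |P(x - y)|²}`. -/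
noncomputable def infUpperTangent {n : ℕ} (X : Submodule ℝ (EuclideanSpace ℝ (Fin n)))
    {ι : Type*} (q : ι → EuclideanSpace ℝ (Fin n)) (t : ι → ℝ)
    (ξ : ι → EuclideanSpace ℝ (Fin n)) (φ : ι → X → ℝ) (a : ℝ)
    (x : EuclideanSpace ℝ (Fin n)) : ℝ :=
  ⨅ i, upperTangent X q t ξ φ a x i

/-! Sufficiency. Since the differences of the slopes span X, all `ξ i` have the same component v in
X^⊥, so each tangent is an affine function of P(x) plus ⟨v, x⟩ and the problem descends to X. There
the tangent inequality puts every affine tangent below the infimum g₀ of the upper tangents, hence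
below its convex envelope. At a base point the corresponding upper tangent takes the prescribed
value, so the envelope has the right value there and, once differentiable, the right gradient.

Regularity comes from one-sided second differences: the quadratic penalty lets only base points in a
bounded region compete, where the Lipschitz constants are uniform
(`iInf_tangent_second_difference`). The spanning slopes make g₀ grow linearly above a linear
function (`exists_coercive_affine_bound`), which localizes the envelope and passes the estimate to
it (`hullInf_second_difference`). For a convex function the estimate yields C^{1,1}_loc
(`ConvexOn.isC11Loc_of_second_difference`). The same growth gives X_F = X.

Necessity. If F = c ∘ P + ⟨v, ·⟩, take for φ_y the gap between c and its tangent at P(y). Essential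
coercivity forces the gradients of c to span X up to translation, so points can be added one
dimension at a time. -/

section Calculus

/-! ### Gradients, the class C^{1,1}_loc and second differences -/

variable {V W : Type*} [NormedAddCommGroup V] [InnerProductSpace ℝ V] [CompleteSpace V]
  [NormedAddCommGroup W] [InnerProductSpace ℝ W] [CompleteSpace W]

theorem HasGradientAt.comp_continuousLinearMap {f : W → ℝ} {g : W} (L : V →L[ℝ] W) {x : V}
    (h : HasGradientAt f g (L x)) : HasGradientAt (fun y => f (L y)) (L.adjoint g) x := by
  rw [hasGradientAt_iff_hasFDerivAt] at h ⊢
  refine (h.comp x L.hasFDerivAt).congr_fderiv ?_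
  ext y
  simp [ContinuousLinearMap.adjoint_inner_left]

theorem hasGradientAt_inner (v x : V) : HasGradientAt (fun y => ⟪v, y⟫_ℝ) v x := by
  rw [hasGradientAt_iff_hasFDerivAt]
  exact (InnerProductSpace.toDual ℝ V v).hasFDerivAt

theorem HasGradientAt.fun_add {f g : V → ℝ} {u v x : V} (hf : HasGradientAt f u x)
    (hg : HasGradientAt g v x) : HasGradientAt (fun y => f y + g y) (u + v) x := by
  rw [hasGradientAt_iff_hasFDerivAt] at *
  rw [map_add]
  exact hf.add hg

theorem IsC11Loc.comp_continuousLinearMap {f : W → ℝ} (hf : IsC11Loc f) (L : V →L[ℝ] W) :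
    IsC11Loc (fun y => f (L y)) := by
  refine ⟨hf.1.comp L.differentiable, ?_⟩
  have : gradient (fun y => f (L y)) = fun y => L.adjoint (gradient f (L y)) :=
    gradient_eq fun x => (hf.1 (L x)).hasGradientAt.comp_continuousLinearMap L
  rw [this]
  exact L.adjoint.lipschitz.locallyLipschitz.comp (hf.2.comp L.lipschitz.locallyLipschitz)

theorem IsC11Loc.add {f g : V → ℝ} (hf : IsC11Loc f) (hg : IsC11Loc g) :
    IsC11Loc (fun y => f y + g y) := by
  refine ⟨hf.1.fun_add hg.1, ?_⟩
  have : gradient (fun y => f y + g y) = fun y => gradient f y + gradient g y :=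
    gradient_eq fun x => (hf.1 x).hasGradientAt.fun_add (hg.1 x).hasGradientAt
  rw [this]
  exact hf.2.add hg.2

theorem isC11Loc_const (b : ℝ) : IsC11Loc (fun _ : V => b) := by
  refine ⟨differentiable_const b, ?_⟩
  rw [gradient_fun_const']
  exact LocallyLipschitz.const 0

theorem isC11Loc_inner (v : V) : IsC11Loc (fun y => ⟪v, y⟫_ℝ) := by
  refine ⟨fun x => (hasGradientAt_inner v x).differentiableAt, ?_⟩
  rw [gradient_eq (hasGradientAt_inner v)]
  exact LocallyLipschitz.const v

/-- The first-order Taylor estimate for a function whose gradient is Lipschitz on a ball. -/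
theorem abs_taylor_le_of_gradient_lipschitz {f : V → ℝ} (hf : Differentiable ℝ f) {R K : ℝ}
    (hK : 0 ≤ K)
    (hL : ∀ u v : V, ‖u‖ ≤ R → ‖v‖ ≤ R → ‖gradient f u - gradient f v‖ ≤ K * ‖u - v‖)
    {u h : V} (hu : ‖u‖ ≤ R) (huh : ‖u + h‖ ≤ R) :
    |f (u + h) - f u - ⟪gradient f u, h⟫_ℝ| ≤ K * ‖h‖ ^ 2 := by
  have hseg : ∀ x ∈ segment ℝ u (u + h), ‖x‖ ≤ R ∧ ‖x - u‖ ≤ ‖h‖ := by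
    intro x hx
    constructor
    · have := (convex_closedBall (0 : V) R).segment_subset (by simpa using hu)
        (by simpa using huh) hx
      simpa using this
    · simpa using norm_sub_le_of_mem_segment hx
  have := (convex_segment (𝕜 := ℝ) u (u + h)).norm_image_sub_le_of_norm_hasFDerivWithin_le'
    (f := f) (f' := fun x => InnerProductSpace.toDual ℝ V (gradient f x))
    (φ := InnerProductSpace.toDual ℝ V (gradient f u)) (C := K * ‖h‖)
    (fun x _ => (hf x).hasGradientAt.hasFDerivAt.hasFDerivWithinAt) (fun x hx => by
      rw [← map_sub, LinearIsometryEquiv.norm_map]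
      refine (hL x u (hseg x hx).1 hu).trans ?_
      exact mul_le_mul_of_nonneg_left (hseg x hx).2 hK)
    (left_mem_segment ℝ u (u + h)) (right_mem_segment ℝ u (u + h))
  simpa [mul_assoc, pow_two] using this

theorem second_difference_le_of_gradient_lipschitz {f : V → ℝ} (hf : Differentiable ℝ f) {R K : ℝ}
    (hK : 0 ≤ K)
    (hL : ∀ u v : V, ‖u‖ ≤ R → ‖v‖ ≤ R → ‖gradient f u - gradient f v‖ ≤ K * ‖u - v‖)
    {u h : V} (hu : ‖u‖ + ‖h‖ ≤ R) :
    f (u + h) + f (u - h) ≤ 2 * f u + 2 * K * ‖h‖ ^ 2 := by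
  have hu' : ‖u‖ ≤ R := by linarith [norm_nonneg h]
  have h1 := abs_taylor_le_of_gradient_lipschitz hf hK hL hu' ((norm_add_le u h).trans hu)
  have h2 := abs_taylor_le_of_gradient_lipschitz hf hK hL (h := -h) hu'
    ((norm_add_le u (-h)).trans (by simpa using hu))
  rw [inner_neg_right, norm_neg, ← sub_eq_add_neg] at h2
  linarith [abs_le.1 h1, abs_le.1 h2]

theorem IsC11Loc.exists_gradient_lipschitz [FiniteDimensional ℝ V] {f : V → ℝ} (hf : IsC11Loc f)
    (R : ℝ) : ∃ K : ℝ, 0 ≤ K ∧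
      ∀ u v : V, ‖u‖ ≤ R → ‖v‖ ≤ R → ‖gradient f u - gradient f v‖ ≤ K * ‖u - v‖ := by
  obtain ⟨K, hK⟩ := LocallyLipschitzOn.exists_lipschitzOnWith_of_compact
    (isCompact_closedBall (0 : V) R) hf.2.locallyLipschitzOn
  refine ⟨K, K.2, fun u v hu hv => ?_⟩
  simpa [dist_eq_norm] using hK.dist_le_mul u (by simpa using hu) v (by simpa using hv)

/-- A convex function on a finite-dimensional space has a subgradient at every point. -/
theorem ConvexOn.exists_subgradient [FiniteDimensional ℝ V] {c : V → ℝ}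
    (hc : ConvexOn ℝ Set.univ c) (u : V) : ∃ p : V, ∀ h, c u + ⟪p, h⟫_ℝ ≤ c (u + h) := by
  have hcont : Continuous c := by
    simpa [continuousOn_univ] using hc.continuousOn isOpen_univ
  have hconv : Convex ℝ {q : V × ℝ | c q.1 < q.2} := by simpa using hc.convex_strict_epigraph
  obtain ⟨L, hL⟩ := geometric_hahn_banach_point_open hconv
    (isOpen_lt (hcont.comp continuous_fst) continuous_snd) (x := (u, c u)) (by simp)
  have hsplit : ∀ x s, L (x, s) = L (x, 0) + s * L (0, 1) := fun x s => by
    rw [← smul_eq_mul, ← map_smul, ← map_add]; simp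
  set b := L (0, 1) with hb
  -- The separating hyperplane is not vertical, because the strict epigraph contains a point
  -- directly above (u, c u).
  have hb0 : 0 < b := by
    have := hL (u, c u + 1) (by simp)
    rw [hsplit, hsplit u (c u + 1)] at this
    linarith
  refine ⟨-b⁻¹ • (InnerProductSpace.toDual ℝ V).symm (L.comp (.inl ℝ V ℝ)), fun h => ?_⟩
  have key : L (u, 0) + c u * b ≤ L (u + h, 0) + c (u + h) * b := by
    refine le_of_forall_pos_le_add fun ε hε => ?_
    have := hL (u + h, c (u + h) + ε / b) (by simpa using div_pos hε hb0)
    rw [hsplit, hsplit (u + h)] at this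
    have h2 : (c (u + h) + ε / b) * b = c (u + h) * b + ε := by field_simp
    linarith
  have hadd : L (u + h, 0) = L (u, 0) + L (h, 0) := by rw [← map_add]; simp
  rw [inner_smul_left, InnerProductSpace.toDual_symm_apply]
  simp only [ContinuousLinearMap.comp_apply, ContinuousLinearMap.inl_apply, RCLike.conj_to_real]
  have h3 : b * (-b⁻¹ * L (h, 0)) = -L (h, 0) := by field_simp
  nlinarith

/-- A convex function with locally quadratically bounded second differences is `C^{1,1}_loc`. -/
theorem ConvexOn.isC11Loc_of_second_difference [FiniteDimensional ℝ V] {c : V → ℝ}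
    (hc : ConvexOn ℝ Set.univ c)
    (hK : ∀ R : ℝ, ∃ K : ℝ, ∀ u h : V, ‖u‖ ≤ R → ‖h‖ ≤ 1 →
      c (u + h) + c (u - h) ≤ 2 * c u + K * ‖h‖ ^ 2) : IsC11Loc c := by
  choose p hp using hc.exists_subgradient
  have hupper : ∀ R : ℝ, ∃ K : ℝ, 0 ≤ K ∧ ∀ u h : V, ‖u‖ ≤ R → ‖h‖ ≤ 1 →
      c (u + h) ≤ c u + ⟪p u, h⟫_ℝ + K * ‖h‖ ^ 2 := by
    intro R
    obtain ⟨K, hK⟩ := hK R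
    refine ⟨max K 0, le_max_right _ _, fun u h hu hh => ?_⟩
    have h1 := hK u h hu hh
    have h2 := hp u (-h)
    rw [inner_neg_right, ← sub_eq_add_neg, ← sub_eq_add_neg] at h2
    have h3 : K * ‖h‖ ^ 2 ≤ max K 0 * ‖h‖ ^ 2 := by gcongr; exact le_max_left _ _
    linarith
  have hgrad : ∀ u, HasGradientAt c (p u) u := by
    intro u
    obtain ⟨K, hK0, hK⟩ := hupper ‖u‖
    rw [hasGradientAt_iff_isLittleO_nhds_zero]
    have hO : (fun h : V => c (u + h) - c u - ⟪p u, h⟫_ℝ) =O[nhds 0] fun h => ‖h‖ ^ 2 := by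
      refine Asymptotics.IsBigO.of_bound K ?_
      filter_upwards [Metric.closedBall_mem_nhds (0 : V) one_pos] with h hh
      have h1 := hK u h le_rfl (by simpa using hh)
      have h2 := hp u h
      rw [Real.norm_eq_abs, abs_of_nonneg (by linarith), Real.norm_eq_abs,
        abs_of_nonneg (by positivity)]
      linarith
    refine hO.trans_isLittleO ?_
    exact Asymptotics.isLittleO_norm_pow_id one_lt_two
  refine ⟨fun u => (hgrad u).differentiableAt, ?_⟩
  rw [gradient_eq hgrad]
  intro x
  obtain ⟨K, hK0, hK⟩ := hupper (‖x‖ + 1)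
  -- Radius 1/2 keeps ‖u - v‖ ≤ 1, the range in which the quadratic upper bound is available.
  refine ⟨(2 * K).toNNReal, Metric.ball x (1 / 2), Metric.ball_mem_nhds x (by norm_num), ?_⟩
  refine LipschitzOnWith.of_dist_le_mul fun u hu v hv => ?_
  rw [dist_eq_norm, dist_eq_norm, Real.coe_toNNReal _ (by positivity)]
  rw [mem_ball_iff_norm] at hu hv
  have hbd : ∀ y, ‖y - x‖ < 1 / 2 → ‖y‖ ≤ ‖x‖ + 1 := fun y hy => by
    have := norm_le_norm_add_norm_sub' y x
    linarith
  have huv : ‖u - v‖ ≤ 1 := by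
    have := norm_sub_le (u - x) (v - x)
    rw [sub_sub_sub_cancel_right] at this
    linarith
  rcases eq_or_ne (p u - p v) 0 with h0 | h0
  · rw [h0, norm_zero]; positivity
  have hn : 0 < ‖p u - p v‖ := norm_pos_iff.2 h0
  rcases eq_or_ne u v with rfl | hne
  · simp at h0
  have hd : 0 < ‖u - v‖ := norm_pos_iff.2 (sub_ne_zero.2 hne)
  -- A step of length ‖u - v‖ in the direction of the slope difference. Comparing c(v + h) from
  -- below by the tangent at u and from above through v bounds ⟪p u - p v, h⟫ by 2K‖u - v‖².
  set h : V := (‖u - v‖ / ‖p u - p v‖) • (p u - p v) with hh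
  have hhn : ‖h‖ = ‖u - v‖ := by
    rw [hh, norm_smul, Real.norm_of_nonneg (by positivity)]
    field_simp
  have hi : ⟪p u, h⟫_ℝ - ⟪p v, h⟫_ℝ = ‖u - v‖ * ‖p u - p v‖ := by
    rw [← inner_sub_left, hh, inner_smul_right, real_inner_self_eq_norm_sq]
    field_simp
  have h1 := hp u (v + h - u)
  have h2 := hK v h (hbd v hv) (hhn.le.trans huv)
  have h3 := hK u (v - u) (hbd u hu) (by rwa [norm_sub_rev])
  rw [add_sub_cancel] at h1 h3
  rw [add_sub_right_comm, inner_add_right] at h1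
  rw [hhn] at h2
  rw [norm_sub_rev] at h3
  have h4 : ‖u - v‖ * ‖p u - p v‖ ≤ ‖u - v‖ * (2 * K * ‖u - v‖) := by nlinarith
  exact le_of_mul_le_mul_left h4 hd

end Calculus

/-! ### The convex envelope through the convex hull of the graph -/

section ConvexHull

variable {V : Type*} [NormedAddCommGroup V] [InnerProductSpace ℝ V]

/-- The lower boundary of the convex hull of the graph of `g`. -/
noncomputable def hullInf (g : V → ℝ) (x : V) : ℝ :=
  sInf {s | (x, s) ∈ convexHull ℝ (Set.range fun y => (y, g y))}

theorem ConvexOn.le_of_mem_convexHull_graph {g h : V → ℝ} (hh : ConvexOn ℝ Set.univ h)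
    (hle : ∀ z, h z ≤ g z) {x : V} {s : ℝ}
    (hs : (x, s) ∈ convexHull ℝ (Set.range fun y => (y, g y))) : h x ≤ s := by
  have : convexHull ℝ (Set.range fun y => (y, g y)) ⊆ {p : V × ℝ | p.1 ∈ Set.univ ∧ h p.1 ≤ p.2} :=
    convexHull_min (by rintro _ ⟨y, rfl⟩; exact ⟨trivial, hle y⟩) hh.convex_epigraph
  exact (this hs).2

theorem mem_convexHull_graph (g : V → ℝ) (x : V) :
    (x, g x) ∈ convexHull ℝ (Set.range fun y => (y, g y)) :=
  subset_convexHull ℝ _ ⟨x, rfl⟩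

theorem ConvexOn.le_hullInf {g h : V → ℝ} (hh : ConvexOn ℝ Set.univ h)
    (hle : ∀ z, h z ≤ g z) (x : V) : h x ≤ hullInf g x :=
  le_csInf ⟨_, mem_convexHull_graph g x⟩ fun _ hs => hh.le_of_mem_convexHull_graph hle hs

theorem ConvexOn.hullInf_le_of_mem {g h : V → ℝ} (hh : ConvexOn ℝ Set.univ h)
    (hle : ∀ z, h z ≤ g z) {x : V} {s : ℝ}
    (hs : (x, s) ∈ convexHull ℝ (Set.range fun y => (y, g y))) : hullInf g x ≤ s :=
  csInf_le ⟨h x, fun _ hs => hh.le_of_mem_convexHull_graph hle hs⟩ hs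

theorem ConvexOn.hullInf_le {g h : V → ℝ} (hh : ConvexOn ℝ Set.univ h)
    (hle : ∀ z, h z ≤ g z) (x : V) : hullInf g x ≤ g x :=
  hh.hullInf_le_of_mem hle (mem_convexHull_graph g x)

theorem exists_mem_convexHull_graph_lt (g : V → ℝ) (x : V) {ε : ℝ} (hε : 0 < ε) :
    ∃ s, (x, s) ∈ convexHull ℝ (Set.range fun y => (y, g y)) ∧ s < hullInf g x + ε :=
  exists_lt_of_csInf_lt ⟨_, mem_convexHull_graph g x⟩ (lt_add_of_pos_right _ hε)

theorem ConvexOn.convexOn_hullInf {g h : V → ℝ} (hh : ConvexOn ℝ Set.univ h)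
    (hle : ∀ z, h z ≤ g z) : ConvexOn ℝ Set.univ (hullInf g) := by
  refine ⟨convex_univ, fun x _ y _ a b ha hb hab => le_of_forall_pos_le_add fun ε hε => ?_⟩
  obtain ⟨s, hs, hsx⟩ := exists_mem_convexHull_graph_lt g x hε
  obtain ⟨t, ht, hty⟩ := exists_mem_convexHull_graph_lt g y hε
  have h1 : hullInf g (a • x + b • y) ≤ a * s + b * t :=
    hh.hullInf_le_of_mem hle (by simpa using convex_convexHull ℝ _ hs ht ha hb hab)
  have h2 : a * s ≤ a * (hullInf g x + ε) := by gcongr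
  have h3 : b * t ≤ b * (hullInf g y + ε) := by gcongr
  have h4 : a * ε + b * ε = ε := by rw [← add_mul, hab, one_mul]
  simp only [smul_eq_mul]
  linarith

theorem exists_combination_lt_hullInf (g : V → ℝ) (x : V) {ε : ℝ} (hε : 0 < ε) :
    ∃ (ι : Type) (_ : Fintype ι) (w : ι → ℝ) (y : ι → V), (∀ i, 0 ≤ w i) ∧ ∑ i, w i = 1 ∧
      ∑ i, w i • y i = x ∧ ∑ i, w i * g (y i) < hullInf g x + ε := by
  obtain ⟨s, hs, hsx⟩ := exists_mem_convexHull_graph_lt g x hε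
  obtain ⟨ι, _, w, z, hw, hw1, hz, hsum⟩ := mem_convexHull_iff_exists_fintype.1 hs
  choose y hy using hz
  simp only [← hy, Prod.ext_iff, Prod.fst_sum, Prod.snd_sum, Prod.smul_fst, Prod.smul_snd,
    smul_eq_mul] at hsum
  exact ⟨ι, inferInstance, w, y, hw, hw1, hsum.1, hsum.2 ▸ hsx⟩

/-- Second differences of the convex envelope of a coercive function are controlled by second
differences of the function itself. -/
theorem hullInf_second_difference {g : V → ℝ} (l : V →L[ℝ] ℝ) {r B : ℝ} (hr : 0 < r)
    (hlow : ∀ u, l u + r * ‖u‖ - B ≤ g u) (hup : ∀ R : ℝ, ∃ M : ℝ, ∀ u, ‖u‖ ≤ R → g u ≤ M)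
    (hg : ∀ R : ℝ, ∃ K : ℝ, ∀ u h : V, ‖u‖ ≤ R → ‖h‖ ≤ 2 →
      g (u + h) + g (u - h) ≤ 2 * g u + K * ‖h‖ ^ 2) (R : ℝ) :
    ∃ K : ℝ, ∀ u h : V, ‖u‖ ≤ R → ‖h‖ ≤ 1 →
      hullInf g (u + h) + hullInf g (u - h) ≤ 2 * hullInf g u + K * ‖h‖ ^ 2 := by
  have hm : ConvexOn ℝ Set.univ fun u => l u + -B :=
    (l.toLinearMap.convexOn convex_univ).add_const (-B)
  have hmg : ∀ z, l z + -B ≤ g z := fun z => by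
    linarith [hlow z, mul_nonneg hr.le (norm_nonneg z)]
  have hconv := hm.convexOn_hullInf hmg
  have hle := hm.hullInf_le hmg
  obtain ⟨M₀, hM₀⟩ := hup R
  -- M bounds the average of g - l + B over any nearly optimal convex combination for a point of the
  -- R-ball.
  set M : ℝ := max (M₀ + 1 + ‖l‖ * R + B) 1 with hM
  have hM0 : 0 < M := lt_max_of_lt_right one_pos
  obtain ⟨K, hK⟩ := hg (2 * M / r)
  refine ⟨2 * max K 0, fun u h hu hh => le_of_forall_pos_le_add fun δ hδ => ?_⟩
  obtain ⟨ι, _, w, y, hw, hw1, hwy, hwg⟩ :=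
    exists_combination_lt_hullInf g u (ε := min (δ / 2) 1) (by positivity)
  have hε1 := min_le_left (δ / 2) 1
  have hε2 := min_le_right (δ / 2) 1
  classical
  -- By Markov's inequality the points of A carry at least half of the weight, and coercivity puts
  -- them in the ball of radius 2M/r.
  set A : Finset ι := Finset.univ.filter fun i => g (y i) - l (y i) + B ≤ 2 * M with hA
  set Λ : ℝ := ∑ i ∈ A, w i with hΛ
  have hsumM : ∑ i, w i * (g (y i) - l (y i) + B) ≤ M := by
    have h1 : ∑ i, w i * (g (y i) - l (y i) + B) = ∑ i, w i * g (y i) - l u + B := by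
      rw [← hwy, map_sum]
      simp only [map_smul, smul_eq_mul, mul_add, mul_sub, Finset.sum_add_distrib,
        Finset.sum_sub_distrib, ← Finset.sum_mul, hw1, one_mul]
    have h2 := l.le_opNorm u
    have h3 : ‖l‖ * ‖u‖ ≤ ‖l‖ * R := by gcongr
    rw [Real.norm_eq_abs] at h2
    rw [h1]
    refine le_trans ?_ (le_max_left _ _)
    linarith [(abs_le.1 (h2.trans h3)).1, hle u, hM₀ u hu]
  have hΛ2 : 1 / 2 ≤ Λ := by
    have h1 : ∑ i, w i * (2 * M) - ∑ i ∈ A, w i * (2 * M) ≤ M := by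
      refine le_trans ?_ hsumM
      rw [← Finset.sum_add_sum_compl A, add_sub_cancel_left, ← Finset.sum_add_sum_compl A
        (fun i => w i * (g (y i) - l (y i) + B))]
      have h2 : 0 ≤ ∑ i ∈ A, w i * (g (y i) - l (y i) + B) :=
        Finset.sum_nonneg fun i _ => mul_nonneg (hw i) (by linarith [hmg (y i)])
      have h3 : ∑ i ∈ Aᶜ, w i * (2 * M) ≤ ∑ i ∈ Aᶜ, w i * (g (y i) - l (y i) + B) := by
        refine Finset.sum_le_sum fun i hi => mul_le_mul_of_nonneg_left ?_ (hw i)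
        simp only [hA, Finset.mem_compl, Finset.mem_filter, Finset.mem_univ, true_and,
          not_le] at hi
        exact hi.le
      linarith
    rw [← Finset.sum_mul, ← Finset.sum_mul, hw1, ← hΛ] at h1
    by_contra hlt
    nlinarith
  have hΛ0 : 0 < Λ := by linarith
  -- Only the points of A move. The factor Λ⁻¹ ≤ 2 makes the mean displacement exactly h, which is
  -- why g must be controlled for steps of length up to 2.
  set e : ι → V := fun i => if i ∈ A then Λ⁻¹ • h else 0 with he
  have hsume : ∑ i, w i • e i = h := by
    simp only [he, smul_ite, smul_zero, Finset.sum_ite_mem, Finset.univ_inter, ← Finset.sum_smul]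
    rw [← hΛ, smul_smul, mul_inv_cancel₀ hΛ0.ne', one_smul]
  have hplus : hullInf g (u + h) ≤ ∑ i, w i * g (y i + e i) := by
    have h1 := hconv.map_sum_le (t := Finset.univ) (w := w) (p := fun i => y i + e i)
      (fun i _ => hw i) hw1 (fun _ _ => trivial)
    simp only [smul_add, Finset.sum_add_distrib, hwy, hsume, smul_eq_mul] at h1
    exact h1.trans (Finset.sum_le_sum fun i _ => mul_le_mul_of_nonneg_left (hle _) (hw i))
  have hminus : hullInf g (u - h) ≤ ∑ i, w i * g (y i - e i) := by
    have h1 := hconv.map_sum_le (t := Finset.univ) (w := w) (p := fun i => y i - e i)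
      (fun i _ => hw i) hw1 (fun _ _ => trivial)
    simp only [smul_sub, Finset.sum_sub_distrib, hwy, hsume, smul_eq_mul] at h1
    exact h1.trans (Finset.sum_le_sum fun i _ => mul_le_mul_of_nonneg_left (hle _) (hw i))
  have hΛh : ‖Λ⁻¹ • h‖ ≤ 2 := by
    rw [norm_smul, Real.norm_of_nonneg (by positivity)]
    have : Λ⁻¹ ≤ 2 := by rw [inv_le_comm₀ hΛ0 two_pos]; linarith
    nlinarith [norm_nonneg h]
  have hterm : ∀ i, w i * g (y i + e i) + w i * g (y i - e i) ≤
      2 * (w i * g (y i)) + if i ∈ A then w i * (max K 0 * ‖Λ⁻¹ • h‖ ^ 2) else 0 := by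
    intro i
    by_cases hi : i ∈ A
    · simp only [he, hi, if_true]
      have hy : ‖y i‖ ≤ 2 * M / r := by
        rw [le_div_iff₀ hr]
        have := (Finset.mem_filter.1 hi).2
        linarith [hlow (y i)]
      have h1 := hK (y i) (Λ⁻¹ • h) hy hΛh
      have h2 : K * ‖Λ⁻¹ • h‖ ^ 2 ≤ max K 0 * ‖Λ⁻¹ • h‖ ^ 2 := by
        gcongr; exact le_max_left _ _
      have := mul_le_mul_of_nonneg_left (h1.trans (add_le_add_right h2 _)) (hw i)
      linarith
    · simp only [he, hi, if_false, add_zero, sub_zero]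
      linarith
  have hsum := Finset.sum_le_sum fun i (_ : i ∈ Finset.univ) => hterm i
  rw [Finset.sum_add_distrib, Finset.sum_add_distrib, ← Finset.mul_sum, Finset.sum_ite_mem,
    Finset.univ_inter, ← Finset.sum_mul, ← hΛ] at hsum
  have hfin : Λ * (max K 0 * ‖Λ⁻¹ • h‖ ^ 2) ≤ 2 * max K 0 * ‖h‖ ^ 2 := by
    rw [norm_smul, Real.norm_of_nonneg (by positivity)]
    have h1 : Λ * (max K 0 * (Λ⁻¹ * ‖h‖) ^ 2) = Λ⁻¹ * (max K 0 * ‖h‖ ^ 2) := by field_simp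
    have : Λ⁻¹ ≤ 2 := by rw [inv_le_comm₀ hΛ0 two_pos]; linarith
    rw [h1, mul_assoc]
    gcongr
  linarith

end ConvexHull

/-! ### Linear growth from spanning slopes -/

section Coercivity

variable {V : Type*} [NormedAddCommGroup V] [InnerProductSpace ℝ V]

/-- If the differences of the slopes span the space, then the supremum of the affine functions is
essentially coercive, with linear growth. -/
theorem exists_coercive_affine_bound [FiniteDimensional ℝ V] {ι : Type*} [Nonempty ι]
    (s : ι → ℝ) (ζ : ι → V)
    (hspan : diffSpan ζ = ⊤) : ∃ (l : V →L[ℝ] ℝ) (r B : ℝ), 0 < r ∧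
      ∀ u, ∃ i, l u + r * ‖u‖ - B ≤ s i + ⟪ζ i, u⟫_ℝ := by
  rcases subsingleton_or_nontrivial V with hV | hV
  · obtain ⟨i⟩ := ‹Nonempty ι›
    refine ⟨0, 1, -s i, one_pos, fun u => ⟨i, ?_⟩⟩
    rw [Subsingleton.elim u 0]
    simp
  obtain ⟨S, hS, hspanS⟩ := Submodule.fg_span_iff_fg_span_finset_subset _ |>.1
    (IsNoetherian.noetherian (diffSpan ζ))
  have htop : Submodule.span ℝ (S : Set V) = ⊤ := by rw [← hspanS]; exact hspan
  have hne : S.Nonempty := by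
    rw [Finset.nonempty_iff_ne_empty]
    rintro rfl
    simp at htop
  choose i j hij using fun a : S => hS a.2
  set L : V →ₗ[ℝ] (S → ℝ) := LinearMap.pi fun a => innerₗ V (a : V) with hL
  have hLa : ∀ u a, L u a = ⟪(a : V), u⟫_ℝ := fun u a => rfl
  have hker : L.ker = ⊥ := by
    rw [LinearMap.ker_eq_bot']
    intro u hu
    have h1 : u ∈ (Submodule.span ℝ (S : Set V))ᗮ := by
      rw [Submodule.mem_orthogonal]
      intro y hy
      induction hy using Submodule.span_induction with
      | mem x hx => exact (hLa u ⟨x, hx⟩).symm.trans (congrFun hu _)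
      | zero => simp
      | add x y _ _ hx hy => rw [inner_add_left, hx, hy, add_zero]
      | smul a x _ hx => rw [inner_smul_left, hx, mul_zero]
    rw [htop, Submodule.top_orthogonal_eq_bot] at h1
    exact h1
  -- Pairing with a spanning set is injective, so in finite dimension the pairings control the norm.
  obtain ⟨K, hK0, hK⟩ := L.exists_antilipschitzWith hker
  have hK' : ∀ u, ‖u‖ ≤ K * ∑ a : S, |⟪(a : V), u⟫_ℝ| := by
    intro u
    have h1 := hK.le_mul_dist u 0
    rw [map_zero, dist_zero_right, dist_zero_right] at h1
    refine h1.trans (mul_le_mul_of_nonneg_left ?_ K.2)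
    rw [pi_norm_le_iff_of_nonneg (Finset.sum_nonneg fun _ _ => abs_nonneg _)]
    intro a
    rw [hLa, Real.norm_eq_abs]
    exact Finset.single_le_sum (f := fun a : S => |⟪(a : V), u⟫_ℝ|) (fun _ _ => abs_nonneg _)
      (Finset.mem_univ a)
  have hN : (0 : ℝ) < ((Fintype.card S : ℕ) : ℝ) := by
    have : Nonempty S := hne.to_subtype
    exact_mod_cast Fintype.card_pos
  set N : ℝ := ((Fintype.card S : ℕ) : ℝ) with hNdef
  have hKpos : (0 : ℝ) < K := hK0
  -- The mean slope: since 2 max(x, y) = x + y + |x - y|, averaging over the pairs shows that the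
  -- maximum exceeds ⟪m, u⟫ by a multiple of Σ |⟪a, u⟫|, up to the constants absorbed in B.
  set m : V := (2 * N)⁻¹ • ∑ a, (ζ (i a) + ζ (j a)) with hm
  have hmu : ∀ u, 2 * N * ⟪m, u⟫_ℝ = ∑ a, (⟪ζ (i a), u⟫_ℝ + ⟪ζ (j a), u⟫_ℝ) := by
    intro u
    rw [hm, inner_smul_left, sum_inner, RCLike.conj_to_real]
    simp only [inner_add_left]
    field_simp
  refine ⟨innerSL ℝ m, (2 * N * K)⁻¹, ∑ a, (|s (i a)| + |s (j a)|), by positivity, fun u => ?_⟩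
  rw [innerSL_apply_apply]
  by_contra! hcon
  set T : ℝ := ⟪m, u⟫_ℝ + (2 * N * K)⁻¹ * ‖u‖ with hT
  have hpair : ∀ a : S, ⟪ζ (i a), u⟫_ℝ + ⟪ζ (j a), u⟫_ℝ + |⟪(a : V), u⟫_ℝ| < 2 * T := by
    intro a
    have hB := Finset.single_le_sum (f := fun a : S => |s (i a)| + |s (j a)|)
      (fun _ _ => by positivity) (Finset.mem_univ a)
    have h1 := hcon (i a)
    have h2 := hcon (j a)
    have h3 := neg_abs_le (s (i a))
    have h4 := neg_abs_le (s (j a))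
    have h5 := abs_nonneg (s (i a))
    have h6 := abs_nonneg (s (j a))
    rw [hij a, inner_sub_left]
    rcases abs_cases (⟪ζ (i a), u⟫_ℝ - ⟪ζ (j a), u⟫_ℝ) with h | h <;> linarith
  have hsum := Finset.sum_lt_sum_of_nonempty (s := Finset.univ)
    (Finset.univ_nonempty_iff.2 hne.to_subtype) fun a _ => hpair a
  rw [Finset.sum_add_distrib, ← hmu, Finset.sum_const, Finset.card_univ, nsmul_eq_mul, ← hNdef,
    hT] at hsum
  have h1 := hK' u
  have h2 : N * (2 * (⟪m, u⟫_ℝ + (2 * N * K)⁻¹ * ‖u‖)) = 2 * N * ⟪m, u⟫_ℝ + ‖u‖ / K := by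
    field_simp
  rw [h2] at hsum
  have h3 : ‖u‖ / K ≤ ∑ a : S, |⟪(a : V), u⟫_ℝ| := by
    rw [div_le_iff₀ hKpos]; linarith
  linarith

theorem essentiallyCoercive_of_le {c : V → ℝ} (l : V →L[ℝ] ℝ) {r B : ℝ} (hr : 0 < r)
    (h : ∀ u, l u + r * ‖u‖ - B ≤ c u) : EssentiallyCoercive c := by
  refine ⟨l.toLinearMap, Filter.tendsto_atTop_mono (f := fun u => r * ‖u‖ + -B) (fun u => ?_) ?_⟩
  · have := h u
    simp only [ContinuousLinearMap.coe_coe]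
    linarith
  · exact Filter.tendsto_atTop_add_const_right _ _
      (tendsto_norm_cobounded_atTop.const_mul_atTop hr)

end Coercivity

/-! ### The infimum of the upper tangents on X -/

section TangentFamily

variable {V : Type*} [NormedAddCommGroup V] [InnerProductSpace ℝ V]
  {ι : Type*} {s : ι → ℝ} {ζ b : ι → V} {φ : ι → V → ℝ} {a : ℝ}

theorem affine_le_iInf [Nonempty ι] (ha : 0 < a)
    (htan : ∀ i j u, s j + ⟪ζ j, u⟫_ℝ ≤ s i + ⟪ζ i, u⟫_ℝ + φ i u) (j : ι) (u : V) :
    s j + ⟪ζ j, u⟫_ℝ ≤ ⨅ i, (s i + ⟪ζ i, u⟫_ℝ + φ i u + a * ‖u - b i‖ ^ 2) :=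
  le_ciInf fun i => (htan i j u).trans (le_add_of_nonneg_right (by positivity))

theorem bddBelow_range_tangent (ha : 0 < a)
    (htan : ∀ i j u, s j + ⟪ζ j, u⟫_ℝ ≤ s i + ⟪ζ i, u⟫_ℝ + φ i u) (j : ι) (u : V) :
    BddBelow (Set.range fun i => s i + ⟪ζ i, u⟫_ℝ + φ i u + a * ‖u - b i‖ ^ 2) :=
  ⟨s j + ⟪ζ j, u⟫_ℝ, by
    rintro _ ⟨i, rfl⟩
    exact (htan i j u).trans (le_add_of_nonneg_right (by positivity))⟩

theorem iInf_tangent_bddAbove [FiniteDimensional ℝ V] [CompleteSpace V]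
    (ha : 0 < a) (hφ : ∀ i, IsC11Loc (φ i))
    (htan : ∀ i j u, s j + ⟪ζ j, u⟫_ℝ ≤ s i + ⟪ζ i, u⟫_ℝ + φ i u) (j : ι) (R : ℝ) :
    ∃ M, ∀ u, ‖u‖ ≤ R →
      ⨅ i, (s i + ⟪ζ i, u⟫_ℝ + φ i u + a * ‖u - b i‖ ^ 2) ≤ M := by
  have hc : Continuous fun u => s j + ⟪ζ j, u⟫_ℝ + φ j u + a * ‖u - b j‖ ^ 2 := by
    have := (hφ j).1.continuous
    fun_prop
  obtain ⟨M, hM⟩ := (isCompact_closedBall (0 : V) R).bddAbove_image hc.continuousOn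
  exact ⟨M, fun u hu => (ciInf_le (bddBelow_range_tangent ha htan j u) j).trans
    (hM ⟨u, by simpa using hu, rfl⟩)⟩

/-- The infimum of the upper tangents has locally quadratically bounded second differences: the
quadratic penalty makes the tangents at distant base points irrelevant. -/
theorem iInf_tangent_second_difference [Nonempty ι] [FiniteDimensional ℝ V] [CompleteSpace V]
    (ha : 0 < a) (hφ : ∀ i, IsC11Loc (φ i))
    (htan : ∀ i j u, s j + ⟪ζ j, u⟫_ℝ ≤ s i + ⟪ζ i, u⟫_ℝ + φ i u)
    (hlip : ∀ R : ℝ, 0 < R → ∃ K : ℝ, 0 ≤ K ∧ ∀ i u v, ‖b i‖ ≤ R → ‖u‖ ≤ R → ‖v‖ ≤ R →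
      ‖gradient (φ i) u - gradient (φ i) v‖ ≤ K * ‖u - v‖) (R : ℝ) :
    ∃ K : ℝ, ∀ u h : V, ‖u‖ ≤ R → ‖h‖ ≤ 2 →
      (⨅ i, (s i + ⟪ζ i, u + h⟫_ℝ + φ i (u + h) + a * ‖u + h - b i‖ ^ 2)) +
        (⨅ i, (s i + ⟪ζ i, u - h⟫_ℝ + φ i (u - h) + a * ‖u - h - b i‖ ^ 2)) ≤
      2 * (⨅ i, (s i + ⟪ζ i, u⟫_ℝ + φ i u + a * ‖u - b i‖ ^ 2)) + K * ‖h‖ ^ 2 := by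
  obtain ⟨j⟩ := ‹Nonempty ι›
  have : Nonempty ι := ⟨j⟩
  obtain ⟨M, hM⟩ := iInf_tangent_bddAbove (b := b) ha hφ htan j R
  -- D bounds the penalty of a nearly minimizing index: M + 1 bounds the total from above, the j-th
  -- affine function bounds the remaining terms from below.
  set D : ℝ := M + 1 + (|s j| + ‖ζ j‖ * R) with hD
  -- The three entries cover the competing base points, the points u ± h, and positivity.
  set R' : ℝ := max (max (R + 1 + D / a) (R + 2)) 1 with hR'
  obtain ⟨K, hK0, hK⟩ := hlip R' (lt_max_of_lt_right one_pos)
  refine ⟨2 * K + 2 * a, fun u h hu hh => le_of_forall_pos_le_add fun δ hδ => ?_⟩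
  have hε0 : 0 < min (δ / 2) 1 := by positivity
  obtain ⟨i, hi⟩ := exists_lt_of_ciInf_lt (lt_add_of_pos_right
    (⨅ i, (s i + ⟪ζ i, u⟫_ℝ + φ i u + a * ‖u - b i‖ ^ 2)) hε0)
  have hε1 := min_le_left (δ / 2) 1
  have hε2 := min_le_right (δ / 2) 1
  have hb : ‖b i‖ ≤ R' := by
    have h1 := htan i j u
    have h2 := abs_le.1 ((abs_real_inner_le_norm (ζ j) u).trans
      (mul_le_mul_of_nonneg_left hu (norm_nonneg (ζ j))))
    have h3 := neg_abs_le (s j)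
    have h4 : a * ‖u - b i‖ ^ 2 ≤ D := by linarith [hM u hu]
    have h5 : ‖u - b i‖ ^ 2 ≤ D / a := by rw [le_div_iff₀ ha]; linarith
    have h6 : ‖u - b i‖ ≤ 1 + D / a := by nlinarith [sq_nonneg (‖u - b i‖ - 1)]
    have h7 : ‖b i‖ ≤ ‖u‖ + ‖u - b i‖ := norm_le_norm_add_norm_sub u (b i)
    refine le_trans ?_ ((le_max_left _ _).trans (le_max_left _ _))
    linarith
  have hR2 : ‖u‖ + ‖h‖ ≤ R' := by
    refine le_trans ?_ ((le_max_right _ _).trans (le_max_left _ _))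
    linarith
  have hsd := second_difference_le_of_gradient_lipschitz (hφ i).1 hK0
    (fun u v hu hv => hK i u v hb hu hv) hR2
  have hp := ciInf_le (bddBelow_range_tangent (b := b) ha htan j (u + h)) i
  have hn := ciInf_le (bddBelow_range_tangent (b := b) ha htan j (u - h)) i
  have hq : ‖u + h - b i‖ ^ 2 + ‖u - h - b i‖ ^ 2 = 2 * ‖u - b i‖ ^ 2 + 2 * ‖h‖ ^ 2 := by
    have := parallelogram_law_with_norm ℝ (u - b i) h
    rw [show u + h - b i = u - b i + h by abel, show u - h - b i = u - b i - h by abel]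
    linarith
  have hq' := congrArg (a * ·) hq
  simp only [inner_add_right, inner_sub_right] at hp hn hq'
  simp only [inner_add_right, inner_sub_right]
  linarith

/-- The affine functions are convex minorants of the infimum, so their growth passes both to it and
to its envelope. -/
theorem exists_tangent_iInf_bounds [FiniteDimensional ℝ V] [Nonempty ι]
    (ha : 0 < a) (hspan : diffSpan ζ = ⊤)
    (htan : ∀ i j u, s j + ⟪ζ j, u⟫_ℝ ≤ s i + ⟪ζ i, u⟫_ℝ + φ i u) :
    ∃ (l : V →L[ℝ] ℝ) (r B : ℝ), 0 < r ∧
      (∀ u, l u + r * ‖u‖ - B ≤ ⨅ i, (s i + ⟪ζ i, u⟫_ℝ + φ i u + a * ‖u - b i‖ ^ 2)) ∧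
      (∀ u, l u + r * ‖u‖ - B ≤
        hullInf (fun u => ⨅ i, (s i + ⟪ζ i, u⟫_ℝ + φ i u + a * ‖u - b i‖ ^ 2)) u) := by
  obtain ⟨l, r, B, hr, h⟩ := exists_coercive_affine_bound s ζ hspan
  refine ⟨l, r, B, hr, fun u => ?_, fun u => ?_⟩ <;> obtain ⟨i, hi⟩ := h u
  · exact hi.trans (affine_le_iInf ha htan i u)
  · refine hi.trans (ConvexOn.le_hullInf (h := fun u => s i + ⟪ζ i, u⟫_ℝ) ?_
      (affine_le_iInf ha htan i) u)
    exact (convexOn_const (s i) convex_univ).add ((innerₗ V (ζ i)).convexOn convex_univ)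

end TangentFamily

/-! ### Descent to X and the interpolation formula -/

section Sufficiency

/-- The point x minimizes F - ⟨ξ, ·⟩. -/
theorem gradient_eq_of_affine_le {V : Type*} [NormedAddCommGroup V] [InnerProductSpace ℝ V]
    [CompleteSpace V] {F : V → ℝ} {x ξ : V} (hF : DifferentiableAt ℝ F x)
    (h : ∀ y, F x + ⟪ξ, y - x⟫_ℝ ≤ F y) : gradient F x = ξ := by
  have h1 := hF.hasGradientAt.fun_add (hasGradientAt_inner (-ξ) x)
  have hmin : IsLocalMin (fun y => F y + ⟪-ξ, y⟫_ℝ) x := Filter.Eventually.of_forall fun y => by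
    have := h y
    rw [inner_sub_right] at this
    simp only [inner_neg_left]
    linarith
  have h2 := hmin.hasFDerivAt_eq_zero h1.hasFDerivAt
  rw [map_eq_zero_iff _ (InnerProductSpace.toDual ℝ V).injective, ← sub_eq_add_neg] at h2
  exact sub_eq_zero.1 h2

variable {n : ℕ} {X : Submodule ℝ (EuclideanSpace ℝ (Fin n))}

theorem inner_eq_zero_of_mem_orthogonal {v : EuclideanSpace ℝ (Fin n)} (hv : v ∈ Xᗮ) (u : X) :
    ⟪v, (u : EuclideanSpace ℝ (Fin n))⟫_ℝ = 0 :=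
  Submodule.inner_left_of_mem_orthogonal u.2 hv

theorem inner_coe_eq_inner_orthogonalProjectionOnto (u : X) (x : EuclideanSpace ℝ (Fin n)) :
    ⟪(u : EuclideanSpace ℝ (Fin n)), x⟫_ℝ = ⟪u, X.orthogonalProjectionOnto x⟫_ℝ := by
  simp

theorem diffSpan_eq_map_subtype {ι : Type*} {ξ : ι → EuclideanSpace ℝ (Fin n)}
    {v : EuclideanSpace ℝ (Fin n)} {ζ : ι → X} (h : ∀ i, ξ i = v + ζ i) :
    diffSpan ξ = (diffSpan ζ).map X.subtype := by
  rw [diffSpan, diffSpan, Submodule.map_span]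
  congr 1
  ext u
  constructor
  · rintro ⟨i, j, rfl⟩
    refine ⟨_, ⟨i, j, rfl⟩, ?_⟩
    rw [h i, h j]
    simp
  · rintro ⟨_, ⟨i, j, rfl⟩, rfl⟩
    refine ⟨i, j, ?_⟩
    rw [h i, h j]
    simp

/-- All slopes agree modulo X, so they share one orthogonal component. -/
theorem exists_orthogonal_decomposition_of_diffSpan_eq {ι : Type*} [Nonempty ι]
    {ξ : ι → EuclideanSpace ℝ (Fin n)} (h : diffSpan ξ = X) :
    ∃ v ∈ Xᗮ, ∃ ζ : ι → X, (∀ i, ξ i = v + ζ i) ∧ diffSpan ζ = ⊤ := by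
  obtain ⟨k⟩ := ‹Nonempty ι›
  have hmem : ∀ i, ξ i - ξ k ∈ X := fun i => h ▸ Submodule.subset_span ⟨i, k, rfl⟩
  set w := ξ k - X.orthogonalProjectionOnto (ξ k) with hw
  obtain ⟨ζ, hdec⟩ : ∃ ζ : ι → X, ∀ i, ξ i = w + ζ i := by
    refine ⟨fun i => X.orthogonalProjectionOnto (ξ i), fun i => ?_⟩
    have h1 := congrArg Subtype.val
      (Submodule.orthogonalProjectionOnto_mem_subspace_eq_self (⟨ξ i - ξ k, hmem i⟩ : X))
    simp only [map_sub, Submodule.coe_sub] at h1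
    rw [hw, sub_add, ← neg_sub (X.orthogonalProjectionOnto (ξ i) : EuclideanSpace ℝ (Fin n)), h1]
    abel
  refine ⟨w, X.sub_starProjection_mem_orthogonal (ξ k), ζ, hdec, ?_⟩
  apply Submodule.map_injective_of_injective X.subtype_injective
  rw [Submodule.map_top, Submodule.range_subtype, ← diffSpan_eq_map_subtype hdec, h]

/-- Taking the envelope commutes with the descent to X: a competing convex function, restricted to
the slice x + X and corrected by ⟪v, x⟫, is a convex minorant of g₀. -/
theorem isGreatest_convexMinorantValues {g : EuclideanSpace ℝ (Fin n) → ℝ} {g₀ h₀ : X → ℝ}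
    {v : EuclideanSpace ℝ (Fin n)} (hv : v ∈ Xᗮ) (hh₀ : ConvexOn ℝ Set.univ h₀)
    (hle : ∀ u, h₀ u ≤ g₀ u) (hg : ∀ x, g x = g₀ (X.orthogonalProjectionOnto x) + ⟪v, x⟫_ℝ)
    (x : EuclideanSpace ℝ (Fin n)) :
    IsGreatest (convexMinorantValues g x)
      (hullInf g₀ (X.orthogonalProjectionOnto x) + ⟪v, x⟫_ℝ) := by
  constructor
  · refine ⟨fun x => hullInf g₀ (X.orthogonalProjectionOnto x) + ⟪v, x⟫_ℝ, ?_, fun z => ?_, rfl⟩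
    · exact ((hh₀.convexOn_hullInf hle).comp_linearMap
        X.orthogonalProjectionOnto.toLinearMap).add ((innerₗ _ v).convexOn convex_univ)
    · rw [hg]
      have := hh₀.hullInf_le hle (X.orthogonalProjectionOnto z)
      linarith
  · rintro _ ⟨h, hh, hhg, rfl⟩
    set y : EuclideanSpace ℝ (Fin n) := x - X.orthogonalProjectionOnto x with hy
    have hconv : ConvexOn ℝ Set.univ fun u : X => h (u + y) + -⟪v, x⟫_ℝ :=
      ((hh.translate_left y).comp_linearMap X.subtype).add_const _
    have h1 := hconv.le_hullInf (g := g₀) (fun u => by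
      have h2 := hhg (u + y)
      have h3 : X.orthogonalProjectionOnto ((u : EuclideanSpace ℝ (Fin n)) + y) = u := by
        rw [hy, map_add, map_sub, Submodule.orthogonalProjectionOnto_mem_subspace_eq_self,
          Submodule.orthogonalProjectionOnto_mem_subspace_eq_self, sub_self, add_zero]
      have h4 : ⟪v, (u : EuclideanSpace ℝ (Fin n)) + y⟫_ℝ = ⟪v, x⟫_ℝ := by
        rw [hy, inner_add_right, inner_sub_right, inner_eq_zero_of_mem_orthogonal hv,
          inner_eq_zero_of_mem_orthogonal hv]
        ring
      rw [hg, h3, h4] at h2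
      linarith) (X.orthogonalProjectionOnto x)
    simp only [hy, add_sub_cancel] at h1
    linarith

variable {ι : Type*} {q : ι → EuclideanSpace ℝ (Fin n)} {t : ι → ℝ}
  {ξ : ι → EuclideanSpace ℝ (Fin n)} {φ : ι → X → ℝ}

theorem TangentConditions.exists_gradient_lipschitz (hT : TangentConditions X q t ξ φ) (R : ℝ)
    (hR : 0 < R) : ∃ K : ℝ, 0 ≤ K ∧ ∀ i u v, ‖X.orthogonalProjectionOnto (q i)‖ ≤ R → ‖u‖ ≤ R →
      ‖v‖ ≤ R → ‖gradient (φ i) u - gradient (φ i) v‖ ≤ K * ‖u - v‖ := by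
  obtain ⟨K, hK⟩ := hT.lipschitz R hR
  refine ⟨max K 0, le_max_right _ _, fun i u v hi hu hv => ?_⟩
  rcases eq_or_ne u v with rfl | hne
  · simp
  have h1 : _ ≤ K := hK ⟨i, u, v, hi, hu, hv, hne, rfl⟩
  exact (div_le_iff₀ (norm_pos_iff.2 (sub_ne_zero.2 hne))).1 (h1.trans (le_max_left _ _))

/-- The convex envelope of the infimum of the upper tangents solves the interpolation problem. -/
theorem TangentConditions.convexEnvelope_infUpperTangent [Nonempty ι]
    (hT : TangentConditions X q t ξ φ) {a : ℝ} (ha : 0 < a) :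
    (∀ x, BddBelow (Set.range (upperTangent X q t ξ φ a x))) ∧
    (∀ x, (convexMinorantValues (infUpperTangent X q t ξ φ a) x).Nonempty ∧
      BddAbove (convexMinorantValues (infUpperTangent X q t ξ φ a) x)) ∧
    ConvexOn ℝ Set.univ (convexEnvelope (infUpperTangent X q t ξ φ a)) ∧
    IsC11Loc (convexEnvelope (infUpperTangent X q t ξ φ a)) ∧
    (∀ i, convexEnvelope (infUpperTangent X q t ξ φ a) (q i) = t i) ∧
    (∀ i, gradient (convexEnvelope (infUpperTangent X q t ξ φ a)) (q i) = ξ i) ∧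
    HasCoercivitySubspace (convexEnvelope (infUpperTangent X q t ξ φ a)) X := by
  obtain ⟨v, hv, ζ, hζ, hspan⟩ := exists_orthogonal_decomposition_of_diffSpan_eq hT.span_eq
  obtain ⟨k⟩ := ‹Nonempty ι›
  have : Nonempty ι := ⟨k⟩
  set P := X.orthogonalProjectionOnto with hP
  set s : ι → ℝ := fun i => t i - ⟪ξ i, q i⟫_ℝ with hs
  set b : ι → X := fun i => P (q i) with hb
  have haff : ∀ i x, t i + ⟪ξ i, x - q i⟫_ℝ = s i + ⟪ζ i, P x⟫_ℝ + ⟪v, x⟫_ℝ := by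
    intro i x
    rw [hs, inner_sub_right, ← inner_coe_eq_inner_orthogonalProjectionOnto]
    conv_lhs => rw [hζ i]
    simp only [inner_add_left, hζ i]
    ring
  have htan : ∀ i j u, s j + ⟪ζ j, u⟫_ℝ ≤ s i + ⟪ζ i, u⟫_ℝ + φ i u := by
    intro i j u
    have h1 := hT.tangent i j u
    rw [haff, haff, ← hP] at h1
    simp only [hP, Submodule.orthogonalProjectionOnto_mem_subspace_eq_self] at h1
    linarith
  set g₀ : X → ℝ := fun u => ⨅ i, (s i + ⟪ζ i, u⟫_ℝ + φ i u + a * ‖u - b i‖ ^ 2) with hg₀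
  have hupper : ∀ x i, upperTangent X q t ξ φ a x i =
      ⟪v, x⟫_ℝ + (s i + ⟪ζ i, P x⟫_ℝ + φ i (P x) + a * ‖P x - b i‖ ^ 2) := by
    intro x i
    rw [upperTangent, haff, map_sub]
    ring
  have hbdd := bddBelow_range_tangent (b := b) ha htan k
  have hg : ∀ x, infUpperTangent X q t ξ φ a x = g₀ (P x) + ⟪v, x⟫_ℝ := by
    intro x
    simp only [infUpperTangent, hupper, hg₀]
    rw [add_comm, add_ciInf (hbdd (P x))]
  have hminor : ∀ j, ConvexOn ℝ Set.univ fun u : X => s j + ⟪ζ j, u⟫_ℝ := fun j =>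
    (convexOn_const (s j) convex_univ).add ((innerₗ X (ζ j)).convexOn convex_univ)
  have hminor_le : ∀ j u, s j + ⟪ζ j, u⟫_ℝ ≤ g₀ u := fun j u => affine_le_iInf ha htan j u
  have hgreat := isGreatest_convexMinorantValues hv (hminor k) (hminor_le k) hg
  have henv : convexEnvelope (infUpperTangent X q t ξ φ a) =
      fun x => hullInf g₀ (P x) + ⟪v, x⟫_ℝ := funext fun x => (hgreat x).csSup_eq
  have hconv₀ : ConvexOn ℝ Set.univ (hullInf g₀) := (hminor k).convexOn_hullInf (hminor_le k)
  obtain ⟨l, r, B, hr, hlow, hlow'⟩ := exists_tangent_iInf_bounds (b := b) ha hspan htan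
  have hc₀ : IsC11Loc (hullInf g₀) := hconv₀.isC11Loc_of_second_difference
    (hullInf_second_difference l hr hlow (iInf_tangent_bddAbove ha hT.c11 htan k)
      (iInf_tangent_second_difference ha hT.c11 htan hT.exists_gradient_lipschitz))
  have hc : IsC11Loc fun x => hullInf g₀ (P x) + ⟪v, x⟫_ℝ :=
    (hc₀.comp_continuousLinearMap P).add (isC11Loc_inner v)
  have hlower : ∀ i x, t i + ⟪ξ i, x - q i⟫_ℝ ≤ hullInf g₀ (P x) + ⟪v, x⟫_ℝ := fun i x => by
    rw [haff]
    have := (hminor i).le_hullInf (hminor_le i) (P x)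
    linarith
  -- At its own base point the i-th upper tangent loses both φ and the penalty, so it meets the
  -- affine lower bound.
  have hval : ∀ i, hullInf g₀ (P (q i)) + ⟪v, q i⟫_ℝ = t i := by
    intro i
    refine le_antisymm ?_ (by simpa using hlower i (q i))
    have h1 := (hminor k).hullInf_le (hminor_le k) (P (q i))
    have h2 := ciInf_le (hbdd (P (q i))) i
    have h3 := haff i (q i)
    rw [hT.value_zero i] at h2
    simp only [sub_self, inner_zero_right, norm_zero, hb] at h2 h3
    have h4 := h1.trans h2
    linarith
  refine ⟨fun x => ?_, fun x => ⟨⟨_, (hgreat x).1⟩, ⟨_, (hgreat x).2⟩⟩, ?_, ?_, ?_, ?_, ?_⟩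
  · refine ⟨t k + ⟪ξ k, x - q k⟫_ℝ, ?_⟩
    rintro _ ⟨i, rfl⟩
    exact (hT.tangent i k x).trans (le_add_of_nonneg_right (by positivity))
  · rw [henv]
    exact (hconv₀.comp_linearMap P.toLinearMap).add ((innerₗ _ v).convexOn convex_univ)
  · rw [henv]; exact hc
  · rw [henv]; exact hval
  · rw [henv]
    exact fun i => gradient_eq_of_affine_le (hc.1 (q i)) fun x => by
      rw [hval]; exact hlower i x
  · rw [henv]
    exact ⟨hullInf g₀, v, hv, essentiallyCoercive_of_le l hr hlow', fun x => rfl⟩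

end Sufficiency

/-! ### Tangent gaps and added points for a given extension -/

section Necessity

theorem diffSpan_eq_span_sub {ι V : Type*} [AddCommGroup V] [Module ℝ V] (ξ : ι → V) (k : ι) :
    diffSpan ξ = Submodule.span ℝ (Set.range fun i => ξ i - ξ k) := by
  apply le_antisymm <;> rw [diffSpan, Submodule.span_le]
  · rintro _ ⟨i, j, rfl⟩
    rw [← sub_sub_sub_cancel_right _ _ (ξ k)]
    exact sub_mem (Submodule.subset_span ⟨i, rfl⟩) (Submodule.subset_span ⟨j, rfl⟩)
  · rintro _ ⟨i, rfl⟩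
    exact Submodule.subset_span ⟨i, k, rfl⟩

/-- Points can be added one at a time until their values span the same subspace as all values. -/
theorem exists_fin_span_union_eq {α V : Type*} [AddCommGroup V] [Module ℝ V]
    [FiniteDimensional ℝ V] (D : α → V) (m : ℕ) (E : Set α)
    (hm : Module.finrank ℝ (Submodule.span ℝ (Set.range D)) -
      Module.finrank ℝ (Submodule.span ℝ (D '' E)) = m) :
    ∃ p : Fin m → α, (∀ j, p j ∉ E) ∧ Function.Injective p ∧
      Submodule.span ℝ (D '' (E ∪ Set.range p)) = Submodule.span ℝ (Set.range D) := by
  have hle : ∀ S : Set α, Submodule.span ℝ (D '' S) ≤ Submodule.span ℝ (Set.range D) :=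
    fun S => Submodule.span_mono (Set.image_subset_range D S)
  induction m generalizing E with
  | zero =>
    refine ⟨Fin.elim0, fun j => j.elim0, fun j => j.elim0, ?_⟩
    rw [Set.range_eq_empty, Set.union_empty]
    exact Submodule.eq_of_le_of_finrank_le (hle E) (by omega)
  | succ m ih =>
    obtain ⟨x, hx⟩ : ∃ x, D x ∉ Submodule.span ℝ (D '' E) := by
      by_contra! hcon
      have h1 : Submodule.span ℝ (Set.range D) ≤ Submodule.span ℝ (D '' E) :=
        Submodule.span_le.2 (Set.range_subset_iff.2 hcon)
      have := Submodule.finrank_mono h1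
      omega
    -- Each new point raises the dimension by exactly one, so the defect counts the points needed.
    have hrank : Module.finrank ℝ (Submodule.span ℝ (D '' insert x E)) =
        Module.finrank ℝ (Submodule.span ℝ (D '' E)) + 1 := by
      rw [Set.image_insert_eq, Submodule.span_insert, sup_comm]
      have hx0 : D x ≠ 0 := fun h => hx (h ▸ zero_mem _)
      have hdisj : Submodule.span ℝ (D '' E) ⊓ Submodule.span ℝ {D x} = ⊥ :=
        disjoint_iff.1 ((Submodule.disjoint_span_singleton' hx0).2 hx)
      have := Submodule.finrank_sup_add_finrank_inf_eq (Submodule.span ℝ (D '' E))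
        (Submodule.span ℝ {D x})
      rw [hdisj, finrank_bot, finrank_span_singleton hx0] at this
      exact this
    obtain ⟨p, hpE, hp, hspan⟩ := ih (insert x E) (by omega)
    refine ⟨Fin.cons x p, fun j => ?_, ?_, ?_⟩
    · refine Fin.cases ?_ (fun j => ?_) j
      · exact fun h => hx (Submodule.subset_span ⟨x, h, rfl⟩)
      · exact fun h => hpE j (Set.mem_insert_of_mem x h)
    · refine Fin.cons_injective_iff.2 ⟨?_, hp⟩
      rintro ⟨j, hj⟩
      exact hpE j (hj ▸ Set.mem_insert x E)
    · rw [Fin.range_cons, Set.union_insert, ← Set.insert_union, hspan]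

/-- Along the line c - l would be affine, and an affine function of r cannot tend to +∞ in both
directions. -/
theorem EssentiallyCoercive.not_affine_on_line {Z : Type*} [NormedAddCommGroup Z]
    [InnerProductSpace ℝ Z] {c : Z → ℝ} (hc : EssentiallyCoercive c) {z : Z} (hz : z ≠ 0)
    (α : ℝ) (h : ∀ r : ℝ, c (r • z) = c 0 + r * α) : False := by
  obtain ⟨l, hl⟩ := hc
  have hz' : 0 < ‖z‖ := norm_pos_iff.2 hz
  have hpos : Filter.Tendsto (fun r : ℝ => c (r • z) - l (r • z)) Filter.atTop Filter.atTop := by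
    refine hl.comp (tendsto_norm_atTop_iff_cobounded.1 ?_)
    simp only [norm_smul, Real.norm_eq_abs]
    exact Filter.tendsto_abs_atTop_atTop.atTop_mul_const hz'
  have hneg : Filter.Tendsto (fun r : ℝ => c ((-r) • z) - l ((-r) • z)) Filter.atTop
      Filter.atTop := by
    refine hl.comp (tendsto_norm_atTop_iff_cobounded.1 ?_)
    simp only [norm_smul, norm_neg, Real.norm_eq_abs]
    exact Filter.tendsto_abs_atTop_atTop.atTop_mul_const hz'
  obtain ⟨r, h1, h2⟩ := ((hpos.eventually_gt_atTop (c 0)).and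
    (hneg.eventually_gt_atTop (c 0))).exists
  rw [h, map_smul, smul_eq_mul] at h1 h2
  linarith

theorem DifferentiableAt.hasDerivAt_comp_line {Z : Type*} [NormedAddCommGroup Z]
    [InnerProductSpace ℝ Z] [CompleteSpace Z] {c : Z → ℝ} {x z : Z} {r : ℝ}
    (hd : DifferentiableAt ℝ c (x + r • z)) :
    HasDerivAt (fun r : ℝ => c (x + r • z)) ⟪gradient c (x + r • z), z⟫_ℝ r := by
  have h1 : HasDerivAt (fun r : ℝ => x + r • z) z r := by
    simpa using ((hasDerivAt_id r).smul_const z).const_add x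
  have h2 := hd.hasGradientAt.hasFDerivAt.comp_hasDerivAt r h1
  rw [InnerProductSpace.toDual_apply_apply] at h2
  exact h2

/-- The gradients of an essentially coercive function do not lie in a proper affine subspace. -/
theorem EssentiallyCoercive.diffSpan_gradient {Z : Type*} [NormedAddCommGroup Z]
    [InnerProductSpace ℝ Z] [FiniteDimensional ℝ Z] [CompleteSpace Z] {c : Z → ℝ}
    (hc : EssentiallyCoercive c) (hd : Differentiable ℝ c) : diffSpan (gradient c) = ⊤ := by
  rw [← Submodule.orthogonal_eq_bot_iff, Submodule.eq_bot_iff]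
  intro z hz
  by_contra hz0
  -- A direction z orthogonal to all gradient differences has constant directional derivative, so c
  -- is affine on ℝz.
  have hconst : ∀ x, ⟪gradient c x, z⟫_ℝ = ⟪gradient c 0, z⟫_ℝ := by
    intro x
    rw [← sub_eq_zero, ← inner_sub_left]
    exact (Submodule.mem_orthogonal _ _).1 hz _ (Submodule.subset_span ⟨x, 0, rfl⟩)
  refine hc.not_affine_on_line hz0 ⟪gradient c 0, z⟫_ℝ fun r => ?_
  have hder : ∀ r : ℝ,
      HasDerivAt (fun r : ℝ => c (0 + r • z) - r * ⟪gradient c 0, z⟫_ℝ) 0 r := by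
    intro r
    have h3 := (hd (0 + r • z)).hasDerivAt_comp_line.sub
      ((hasDerivAt_id r).mul_const ⟪gradient c 0, z⟫_ℝ)
    rw [hconst (0 + r • z), one_mul, sub_self] at h3
    exact h3
  have := is_const_of_deriv_eq_zero (fun r => (hder r).differentiableAt)
    (fun r => (hder r).deriv) r 0
  simp only [zero_smul, zero_mul, sub_zero, zero_add] at this
  linarith

theorem ConvexOn.tangent_le {Z : Type*} [NormedAddCommGroup Z] [InnerProductSpace ℝ Z]
    [FiniteDimensional ℝ Z] [CompleteSpace Z] {c : Z → ℝ} (hc : ConvexOn ℝ Set.univ c)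
    (hd : Differentiable ℝ c) (x y : Z) : c x + ⟪gradient c x, y - x⟫_ℝ ≤ c y := by
  obtain ⟨p, hp⟩ := hc.exists_subgradient x
  have hp' : ∀ y, c x + ⟪p, y - x⟫_ℝ ≤ c y := fun y => by
    have := hp (y - x)
    rwa [add_sub_cancel] at this
  rw [gradient_eq_of_affine_le (hd x) hp']
  exact hp' y

variable {n : ℕ} {X : Submodule ℝ (EuclideanSpace ℝ (Fin n))}

/-- As v is orthogonal to X, c is the restriction of F to X and inherits its regularity and
convexity. -/
theorem HasCoercivitySubspace.exists_c11 {F : EuclideanSpace ℝ (Fin n) → ℝ}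
    (hX : HasCoercivitySubspace F X) (hconv : ConvexOn ℝ Set.univ F) (hF : IsC11Loc F) :
    ∃ c : X → ℝ, ∃ v ∈ Xᗮ, EssentiallyCoercive c ∧ IsC11Loc c ∧ ConvexOn ℝ Set.univ c ∧
      (∀ x, F x = c (X.orthogonalProjectionOnto x) + ⟪v, x⟫_ℝ) ∧
      ∀ x, gradient F x = v + gradient c (X.orthogonalProjectionOnto x) := by
  obtain ⟨c, v, hv, hc, hFc⟩ := hX
  have hcF : c = fun u : X => F (X.subtypeL u) := by
    funext u
    rw [Submodule.subtypeL_apply, hFc, inner_eq_zero_of_mem_orthogonal hv, add_zero,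
      Submodule.orthogonalProjectionOnto_mem_subspace_eq_self]
  have hc11 : IsC11Loc c := hcF ▸ hF.comp_continuousLinearMap X.subtypeL
  refine ⟨c, v, hv, hc, hc11, hcF ▸ hconv.comp_linearMap X.subtype, hFc, fun x => ?_⟩
  have h1 := ((hc11.1 (X.orthogonalProjectionOnto x)).hasGradientAt.comp_continuousLinearMap
    X.orthogonalProjectionOnto).fun_add (hasGradientAt_inner v x)
  rw [Submodule.adjoint_orthogonalProjectionOnto, ← funext hFc] at h1
  rw [h1.gradient, add_comm, Submodule.subtypeL_apply]

theorem HasCoercivitySubspace.diffSpan_gradient {F : EuclideanSpace ℝ (Fin n) → ℝ}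
    (hX : HasCoercivitySubspace F X) (hconv : ConvexOn ℝ Set.univ F) (hF : IsC11Loc F) :
    diffSpan (gradient F) = X := by
  obtain ⟨c, v, hv, hc, hc11, -, -, hgrad⟩ := hX.exists_c11 hconv hF
  rw [diffSpan_eq_map_subtype hgrad]
  have htop : diffSpan (fun x => gradient c (X.orthogonalProjectionOnto x)) = ⊤ := by
    rw [eq_top_iff, ← hc.diffSpan_gradient hc11.1]
    refine Submodule.span_mono ?_
    rintro _ ⟨u, u', rfl⟩
    exact ⟨u, u', by simp only [Submodule.orthogonalProjectionOnto_mem_subspace_eq_self]⟩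
  rw [htop, Submodule.map_top, Submodule.range_subtype]

/-- The gap between a convex `C^{1,1}_loc` function and its tangents satisfies the tangent
conditions at every family of points whose gradients span. -/
theorem HasCoercivitySubspace.exists_tangentConditions {F : EuclideanSpace ℝ (Fin n) → ℝ}
    (hX : HasCoercivitySubspace F X) (hconv : ConvexOn ℝ Set.univ F) (hF : IsC11Loc F)
    {ι : Type*} (q : ι → EuclideanSpace ℝ (Fin n))
    (hspan : diffSpan (fun i => gradient F (q i)) = X) :
    ∃ φ : ι → X → ℝ,
      TangentConditions X q (fun i => F (q i)) (fun i => gradient F (q i)) φ := by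
  obtain ⟨c, v, hv, -, hc11, hcconv, hFc, hgrad⟩ := hX.exists_c11 hconv hF
  set P := X.orthogonalProjectionOnto with hP
  set φ : ι → X → ℝ := fun i u => c u + ⟪-gradient c (P (q i)), u⟫_ℝ +
    (⟪gradient c (P (q i)), P (q i)⟫_ℝ - c (P (q i))) with hφ
  have hφ' : ∀ i u, φ i u = c u - (c (P (q i)) + ⟪gradient c (P (q i)), u - P (q i)⟫_ℝ) := by
    intro i u
    simp only [hφ, inner_neg_left, inner_sub_right]
    ring
  have hφgrad : ∀ i, gradient (φ i) = fun u => gradient c u - gradient c (P (q i)) := by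
    intro i
    refine gradient_eq fun u => ?_
    have h1 := ((hc11.1 u).hasGradientAt.fun_add
      (hasGradientAt_inner (-gradient c (P (q i))) u)).fun_add
      (hasGradientAt_const u (⟪gradient c (P (q i)), P (q i)⟫_ℝ - c (P (q i))))
    rwa [add_zero, ← sub_eq_add_neg] at h1
  refine ⟨φ, ⟨fun i u => ?_, fun i => ?_, hspan, fun i => ?_, fun i => ?_, fun R hR => ?_,
    fun i j x => ?_⟩⟩
  · rw [hφ', sub_nonneg]
    exact hcconv.tangent_le hc11.1 _ _
  · exact (hc11.add (isC11Loc_inner _)).add (isC11Loc_const _)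
  · rw [hφ', sub_self, inner_zero_right, add_zero, sub_self]
  · rw [hφgrad]
    exact sub_self _
  -- Each ∇φ_i differs from ∇c by a constant, so one Lipschitz constant serves all i, wherever the
  -- base points lie.
  · obtain ⟨K, -, hK⟩ := hc11.exists_gradient_lipschitz R
    refine ⟨K, ?_⟩
    rintro _ ⟨i, u, w, -, hu, hw, hne, rfl⟩
    rw [hφgrad, sub_sub_sub_cancel_right, div_le_iff₀ (norm_pos_iff.2 (sub_ne_zero.2 hne))]
    exact hK u w hu hw
  -- The right-hand side of the condition is exactly F(x).
  · have h1 := hconv.tangent_le hF.1 (q j) x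
    refine h1.trans_eq ?_
    rw [hφ', hgrad, hFc, hFc (q i), inner_add_left, inner_coe_eq_inner_orthogonalProjectionOnto,
      map_sub, inner_sub_right v]
    ring

theorem IsConvexC11Extension.exists_admissible {E : Set (EuclideanSpace ℝ (Fin n))}
    (hE : E.Nonempty) {f : E → ℝ} {G : E → EuclideanSpace ℝ (Fin n)}
    {F : EuclideanSpace ℝ (Fin n) → ℝ} (hF : IsConvexC11Extension E X f G F) :
    diffSpan G ≤ X ∧
      ∃ (p : Fin (defect X G) → EuclideanSpace ℝ (Fin n)) (β : Fin (defect X G) → ℝ)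
        (w : Fin (defect X G) → EuclideanSpace ℝ (Fin n))
        (φ : E ⊕ Fin (defect X G) → X → ℝ), IsAdmissible E X f G p β w φ := by
  have hspan := hF.subspace.diffSpan_gradient hF.convex hF.c11
  obtain ⟨e, he⟩ := hE
  -- Subtracting the gradient at a fixed point of E turns spans of differences into ordinary spans.
  set D : EuclideanSpace ℝ (Fin n) → EuclideanSpace ℝ (Fin n) :=
    fun x => gradient F x - gradient F e with hD
  have hDX : Submodule.span ℝ (Set.range D) = X := by rw [← hspan, diffSpan_eq_span_sub _ e]
  have hDE : Submodule.span ℝ (D '' E) = diffSpan G := by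
    rw [diffSpan_eq_span_sub _ ⟨e, he⟩, ← hF.grad ⟨e, he⟩]
    simp only [← hF.grad]
    rw [Set.image_eq_range]
  constructor
  · rw [← hDE, ← hDX]
    exact Submodule.span_mono (Set.image_subset_range D E)
  obtain ⟨p, hpE, hp, hpspan⟩ := exists_fin_span_union_eq D (defect X G) E
    (by rw [hDX, hDE, defect])
  have hq : diffSpan (fun i => gradient F (enlarge E p i)) = X := by
    rw [diffSpan_eq_span_sub _ (Sum.inl ⟨e, he⟩)]
    refine Eq.trans ?_ (hpspan.trans hDX)
    congr 1
    have hr : E ∪ Set.range p = Set.range (enlarge E p) := by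
      rw [enlarge, Set.Sum.elim_range, Subtype.range_coe]
    rw [hr, ← Set.range_comp]
    rfl
  obtain ⟨φ, hφ⟩ := hF.subspace.exists_tangentConditions hF.convex hF.c11 (enlarge E p) hq
  refine ⟨p, fun j => F (p j), fun j => gradient F (p j), φ, hpE, hp, ?_⟩
  convert hφ using 1 <;> funext i <;> rcases i with y | j
  · exact (hF.value y).symm
  · rfl
  · exact (hF.grad y).symm
  · rfl

end Necessity

theorem mainTheorem4 {n : ℕ} (E : Set (EuclideanSpace ℝ (Fin n))) (hE : E.Nonempty)
    (X : Submodule ℝ (EuclideanSpace ℝ (Fin n)))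
    (f : E → ℝ) (G : E → EuclideanSpace ℝ (Fin n)) :
    -- the characterization; if `dim Y = dim X` then `defect X G = 0` and no point is added
    ((∃ F : EuclideanSpace ℝ (Fin n) → ℝ, IsConvexC11Extension E X f G F) ↔
      (diffSpan G ≤ X ∧
        ∃ (p : Fin (defect X G) → EuclideanSpace ℝ (Fin n)) (β : Fin (defect X G) → ℝ)
          (w : Fin (defect X G) → EuclideanSpace ℝ (Fin n))
          (φ : E ⊕ Fin (defect X G) → X → ℝ),
          IsAdmissible E X f G p β w φ)) ∧
    -- the formula; its infimum and its supremum are taken over bounded nonempty sets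
    (diffSpan G ≤ X →
      ∀ (p : Fin (defect X G) → EuclideanSpace ℝ (Fin n)) (β : Fin (defect X G) → ℝ)
        (w : Fin (defect X G) → EuclideanSpace ℝ (Fin n))
        (φ : E ⊕ Fin (defect X G) → X → ℝ),
        IsAdmissible E X f G p β w φ →
        ∀ a : ℝ, 0 < a →
          (∀ x, BddBelow (Set.range
            (upperTangent X (enlarge E p) (Sum.elim f β) (Sum.elim G w) φ a x))) ∧
          (∀ x,
            (convexMinorantValues
              (infUpperTangent X (enlarge E p) (Sum.elim f β) (Sum.elim G w) φ a) x).Nonempty ∧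
            BddAbove (convexMinorantValues
              (infUpperTangent X (enlarge E p) (Sum.elim f β) (Sum.elim G w) φ a) x)) ∧
          IsConvexC11Extension E X f G
            (convexEnvelope
              (infUpperTangent X (enlarge E p) (Sum.elim f β) (Sum.elim G w) φ a))) := by
  have hsuff : diffSpan G ≤ X →
      ∀ (p : Fin (defect X G) → EuclideanSpace ℝ (Fin n)) (β : Fin (defect X G) → ℝ)
        (w : Fin (defect X G) → EuclideanSpace ℝ (Fin n))
        (φ : E ⊕ Fin (defect X G) → X → ℝ),
        IsAdmissible E X f G p β w φ →
        ∀ a : ℝ, 0 < a →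
          (∀ x, BddBelow (Set.range
            (upperTangent X (enlarge E p) (Sum.elim f β) (Sum.elim G w) φ a x))) ∧
          (∀ x,
            (convexMinorantValues
              (infUpperTangent X (enlarge E p) (Sum.elim f β) (Sum.elim G w) φ a) x).Nonempty ∧
            BddAbove (convexMinorantValues
              (infUpperTangent X (enlarge E p) (Sum.elim f β) (Sum.elim G w) φ a) x)) ∧
          IsConvexC11Extension E X f G
            (convexEnvelope
              (infUpperTangent X (enlarge E p) (Sum.elim f β) (Sum.elim G w) φ a)) := by
    intro _ p β w φ hA a ha
    have : Nonempty (E ⊕ Fin (defect X G)) := ⟨Sum.inl ⟨_, hE.some_mem⟩⟩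
    obtain ⟨hbelow, hminor, hconv, hc11, hval, hgrad, hX⟩ :=
      hA.conditions.convexEnvelope_infUpperTangent ha
    exact ⟨hbelow, hminor, hconv, hc11, fun y => hval (Sum.inl y), fun y => hgrad (Sum.inl y), hX⟩
  refine ⟨⟨fun ⟨F, hF⟩ => hF.exists_admissible hE, ?_⟩, hsuff⟩
  rintro ⟨hle, p, β, w, φ, hA⟩
  exact ⟨_, (hsuff hle p β w φ hA 1 one_pos).2.2⟩
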